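/- Let $\log$ denote the logarithm to base $2$ and let $N\ge 1$ be an integer. A source $U\sim\mathsf{Unif}([-1/2,1/2])$ is sent over $N$ uses of an additive white Gaussian noise channel: for measurable encoding functions $\phi_1,\dots,\phi_N:\mathbb R\to\mathbb R$ and a measurable decoding function $\psi:\mathbb R^N\to\mathbb R$, one transmits $X_n=\phi_n(U)$, the receiver observes $Y_n=X_n+Z_n$, where $Z_1,\dots,Z_N$ are i.i.d. $\mathcal N(0,\sigma^2)$ and independent of $U$, and it outputs $\hat U=\psi(Y_1,\dots,Y_N)$. The scheme achieves distortion $D$ at power $P$ and noise level $\sigma$ if $\mathbb E\big[\frac1N\sum_{n}|X_n|^2\big]\le P$ and $\mathbb E\big[|\hat U-U|^2\big]\le D$. A channel-agnostic strategy chooses for every $P>0$ and $\sigma>0$ a scheme that satisfies the power constraint $P$, in such a way that the encoding functions do not depend on $P$ and $\sigma$ except for the scaling to the available power, that is, $X_n=\sqrt P\,\varphi_n(U)$ with fixed functions $\varphi_n$ (the decoding function may depend on $P$ and $\sigma$). Let $D^*=D^*(N,P,\sigma)$ be the infimum of all $D$ that are achieved at $(P,\sigma)$ by some channel-agnostic strategy,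 and put $\mathsf{SNR}=P/\sigma^2$ and $\mathsf{SDR}^*=\mathbb E[(U-\mathbb E U)^2]/D^*=1/(12D^*)$. Then $D^*>0$ and $$\log \mathsf{SDR}^*\;\le\; N\log(1+\mathsf{SNR})+\log\frac{\pi e}{6}\qquad\text{for all }P,\sigma>0,$$ $$N\log\mathsf{SNR}-10N\log\log\mathsf{SNR}+o(\log\log\mathsf{SNR})\;\le\;\log\mathsf{SDR}^*\qquad\text{for }\mathsf{SNR}>1,$$ where the $o(\cdot)$ term is a function of $\mathsf{SNR}$ (and $N$) only, and refers to $\mathsf{SNR}\to\infty$. Moreover, there is a single channel-agnostic strategy, achieving distortions $D(P,\sigma)>0$ at all $P,\sigma>0$, whose ratio $\mathsf{SDR}=1/(12D(P,\sigma))$ satisfies the same lower bound in place of $\mathsf{SDR}^*$, so that $\big|N\log(1+\mathsf{SNR})-\log\mathsf{SDR}\big|=O(\log\log\mathsf{SNR})$ as $\mathsf{SNR}\to\infty$. -/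

import Mathlib

open MeasureTheory ProbabilityTheory Filter Asymptotics
open scoped NNReal ENNReal

namespace FewShot

/-- An `(M, N)` few-shot joint source-channel coding scheme: `N` encoding functions
`φₙ : ℝ^M → ℝ` and one decoding function `ψ : ℝ^N → ℝ^M`, all Borel measurable. -/
structure Scheme (M N : ℕ) where
  enc : Fin N → (Fin M → ℝ) → ℝ
  dec : (Fin N → ℝ) → (Fin M → ℝ)
  measurable_enc : ∀ n, Measurable (enc n)
  measurable_dec : Measurable dec

/-- Law of `M` i.i.d. source symbols with common law `ν`. -/
noncomputable def sourceLaw (ν : Measure ℝ) (M : ℕ) : Measure (Fin M → ℝ) :=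
  Measure.pi fun _ => ν

/-- Law of `N` i.i.d. centred Gaussian noise samples of variance `σ²`. -/
noncomputable def noiseLaw (σ : ℝ≥0) (N : ℕ) : Measure (Fin N → ℝ) :=
  Measure.pi fun _ => gaussianReal 0 (σ ^ 2)

/-- Average transmit power `E[(1/N) ∑ₙ |Xₙ|²]`, where `Xₙ = φₙ(U₁, …, U_M)`. -/
noncomputable def Scheme.power {M N : ℕ} (S : Scheme M N) (ν : Measure ℝ) : ℝ≥0∞ :=
  ∫⁻ u, ENNReal.ofReal ((1 / (N : ℝ)) * ∑ n, (S.enc n u) ^ 2) ∂(sourceLaw ν M)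

/-- Average distortion `E[(1/M) ∑ₘ |Ûₘ - Uₘ|²]`, where `Û = ψ(Y₁, …, Y_N)`, `Yₙ = Xₙ + Zₙ`, and
the noise `Z` is independent of the source `U`. -/
noncomputable def Scheme.distortion {M N : ℕ} (S : Scheme M N) (ν : Measure ℝ) (σ : ℝ≥0) :
    ℝ≥0∞ :=
  ∫⁻ p : (Fin M → ℝ) × (Fin N → ℝ),
    ENNReal.ofReal ((1 / (M : ℝ)) *
      ∑ m, (S.dec (fun n => S.enc n p.1 + p.2 n) m - p.1 m) ^ 2)
    ∂((sourceLaw ν M).prod (noiseLaw σ N))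

/-- The scheme meets the power constraint `P` and the distortion constraint `D` over the AWGN
channel with noise standard deviation `σ`. -/
def Scheme.Achieves {M N : ℕ} (S : Scheme M N) (ν : Measure ℝ) (σ P D : ℝ≥0) : Prop :=
  S.power ν ≤ P ∧ S.distortion ν σ ≤ D

/-- A coding strategy assigns to every power budget `P` and noise level `σ` a scheme. -/
abbrev Strategy (M N : ℕ) := (P σ : ℝ≥0) → Scheme M N

/-- A strategy is channel agnostic if its encoding functions are the same for all `P` and `σ`,
with the power normalised to one: the `n`-th transmitted symbol is `√P · φₙ(U)` with `φₙ` a fixed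
function. (In particular, for `P = 1` the encoder is literally the same for all `σ`.)
The receiver may know the channel, so that the decoding function is unrestricted. -/
def Strategy.IsChannelAgnostic {M N : ℕ} (A : Strategy M N) : Prop :=
  ∃ φ : Fin N → (Fin M → ℝ) → ℝ, ∀ P σ : ℝ≥0, 0 < P → 0 < σ →
    ∀ n u, (A P σ).enc n u = √(P : ℝ) * φ n u

/-- The smallest distortion achievable by channel-agnostic strategies at power `P` and noise
level `σ`: the infimum of all `D` for which some channel-agnostic strategy, which respects every
power budget, achieves distortion `D` at `(P, σ)`. -/
noncomputable def optDistortion (ν : Measure ℝ) (M N : ℕ) (P σ : ℝ≥0) : ℝ≥0 :=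
  sInf {D : ℝ≥0 | ∃ A : Strategy M N, A.IsChannelAgnostic ∧
    (∀ P' σ' : ℝ≥0, 0 < P' → 0 < σ' → (A P' σ').power ν ≤ P') ∧
    (A P σ).Achieves ν σ P D}

/-- The signal-to-distortion ratio `E[(U - E U)²] / D`. -/
noncomputable def sdr (ν : Measure ℝ) (D : ℝ≥0) : ℝ :=
  variance id ν / D

/-- The signal-to-noise ratio `P / σ²`. -/
noncomputable def snr (P σ : ℝ≥0) : ℝ :=
  (P : ℝ) / (σ : ℝ) ^ 2

/-- The uniform distribution on `[-1/2, 1/2]` (an interval of length one). -/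
noncomputable def unif : Measure ℝ :=
  volume.restrict (Set.Icc (-(1 / 2)) (1 / 2))

/-- Logarithm to base two. -/
noncomputable def lg (x : ℝ) : ℝ := Real.logb 2 x

end FewShot

/-!
The upper bound on the signal-to-distortion ratio is a single application of Gibbs' inequality.
With `v = σ²`, `w = P + σ²` and a scheme of distortion at most `d`, the function
`(u, y) ↦ g_d (u - ψ y) ∏ₙ g_w (yₙ)`, where `g` denotes centred Gaussian densities, has total mass
at most one over the source interval, so the expected logarithm of its ratio to the joint density of
source and channel output is at most zero (`Scheme.lintegral_ratio_le`, `integral_log_nonpos`). This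
logarithm is quadratic in the reconstruction error, the output and the noise, whose second moments
are bounded by `d`, by `w` on average over the channel uses, and equal to `v`; what remains is
`1 ≤ 2πe d (1 + P/σ²)^N` (`Scheme.Achieves.one_le`). No entropies occur.

For the lower bound, the binary digits of `u + 1/2` are dealt out to the `N` channel uses in turn,
and each channel use transmits its digits with the weights `2⁻ᵏ (1 + 1/(k + 1))` in place of `2⁻ᵏ`.
The excess leaves a gap of at least `2⁻ᵏ / ((k + 1)(k + 2))` between inputs whose digits first
differ at position `k`, at all scales `k` simultaneously
(`digits_eq_of_abs_gapExpansion_sub_lt`), so the encoder need not know the channel. If the noise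
stays below half the `K`-th gap, a decoder recovers the first `N (K + 1)` digits of the source
(`exists_decoder`). At signal-to-noise ratio `s`, the noise is of order at most `√(log s / s)`
relative to the signal, except on an event of probability `O(s⁻ᴺ)`, so `2⁻ᴷ` can be taken of order
`(log s)⁴ / √s`. The distortion is then `O((log s)^(8 N) s⁻ᴺ)`
(`exists_interleaveScheme_distortion_le`), which is better than the factor `(log s)^(10 N)` that
the theorem allows.
-/

namespace FewShot

/-! ### Product measures with densities -/

theorem pi_withDensity {ι : Type*} [Fintype ι] {α : ι → Type*} [∀ i, MeasurableSpace (α i)]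
    (μ : ∀ i, Measure (α i)) [∀ i, IsProbabilityMeasure (μ i)] {f : ∀ i, α i → ℝ≥0∞}
    (hf : ∀ i, Measurable (f i)) [∀ i, SigmaFinite ((μ i).withDensity (f i))] :
    Measure.pi (fun i => (μ i).withDensity (f i)) =
      (Measure.pi μ).withDensity (fun x => ∏ i, f i (x i)) := by
  refine Measure.pi_eq fun s hs => ?_
  rw [withDensity_apply _ (MeasurableSet.univ_pi hs),
    ← lintegral_indicator (MeasurableSet.univ_pi hs)]
  have hind : ∀ i, Measurable ((s i).indicator (f i)) := fun i => (hf i).indicator (hs i)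
  have h : (Set.univ.pi s).indicator (fun x => ∏ i, f i (x i)) =
      fun x => ∏ i, (s i).indicator (f i) (x i) := by
    ext x
    by_cases hx : x ∈ Set.univ.pi s
    · rw [Set.indicator_of_mem hx]
      exact Finset.prod_congr rfl fun i _ => (Set.indicator_of_mem (hx i trivial) _).symm
    · rw [Set.indicator_of_notMem hx]
      obtain ⟨i, hi⟩ : ∃ i, x i ∉ s i := by simpa using hx
      exact (Finset.prod_eq_zero (Finset.mem_univ i) (Set.indicator_of_notMem hi _)).symm
  have hindep := lintegral_prod_eq_prod_lintegral_of_indepFun Finset.univ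
    (fun i x => (s i).indicator (f i) (x i)) (iIndepFun_pi fun i => (hind i).aemeasurable)
    (μ := Measure.pi μ) fun i => (hind i).comp (measurable_pi_apply i)
  rw [h, hindep]
  refine Finset.prod_congr rfl fun i _ => ?_
  rw [withDensity_apply _ (hs i), ← lintegral_indicator (hs i)]
  exact (measurePreserving_eval μ i).lintegral_comp (hind i)

theorem gaussianReal_withDensity_div (a : ℝ) {v w : ℝ≥0} (hv : v ≠ 0) (hw : w ≠ 0) :
    (gaussianReal a v).withDensity
        (fun x => ENNReal.ofReal (gaussianPDFReal 0 w x / gaussianPDFReal a v x)) =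
      gaussianReal 0 w := by
  have hmeas : Measurable fun x =>
      ENNReal.ofReal (gaussianPDFReal 0 w x / gaussianPDFReal a v x) :=
    ((measurable_gaussianPDFReal 0 w).div (measurable_gaussianPDFReal a v)).ennreal_ofReal
  rw [gaussianReal_of_var_ne_zero a hv, gaussianReal_of_var_ne_zero 0 hw,
    ← withDensity_mul _ (measurable_gaussianPDF a v) hmeas]
  congr 1
  ext x
  have hpos := gaussianPDFReal_pos a v x hv
  rw [Pi.mul_apply, gaussianPDF_def, gaussianPDF_def, ← ENNReal.ofReal_mul hpos.le,
    mul_div_cancel₀ _ hpos.ne']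

/-- Change of measure for the channel output: weighting the law of `a + Z` by the likelihood
ratio turns it into the law of `N` independent centred Gaussians of variance `w`. -/
theorem lintegral_shift_mul_likelihoodRatio {N : ℕ} (a : Fin N → ℝ) {v w : ℝ≥0} (hv : v ≠ 0)
    (hw : w ≠ 0) {F : (Fin N → ℝ) → ℝ≥0∞} (hF : Measurable F) :
    ∫⁻ z, F (fun n => a n + z n) * ∏ n, ENNReal.ofReal
        (gaussianPDFReal 0 w (a n + z n) / gaussianPDFReal (a n) v (a n + z n))
        ∂(Measure.pi fun _ => gaussianReal 0 v) =
      ∫⁻ y, F y ∂(Measure.pi fun _ => gaussianReal 0 w) := by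
  have hmeas : ∀ n, Measurable fun x =>
      ENNReal.ofReal (gaussianPDFReal 0 w x / gaussianPDFReal (a n) v x) := fun n =>
    ((measurable_gaussianPDFReal 0 w).div (measurable_gaussianPDFReal (a n) v)).ennreal_ofReal
  have hprod : Measurable fun y : Fin N → ℝ => ∏ n, ENNReal.ofReal
      (gaussianPDFReal 0 w (y n) / gaussianPDFReal (a n) v (y n)) :=
    Finset.measurable_prod _ fun n _ => (hmeas n).comp (measurable_pi_apply n)
  have hshift : MeasurePreserving (fun (z : Fin N → ℝ) n => a n + z n)
      (Measure.pi fun _ => gaussianReal 0 v) (Measure.pi fun n => gaussianReal (a n) v) :=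
    measurePreserving_pi _ _ fun n =>
      ⟨measurable_const_add _, by rw [gaussianReal_map_const_add, zero_add]⟩
  have hdens : (Measure.pi fun _ : Fin N => gaussianReal 0 w) =
      (Measure.pi fun n => gaussianReal (a n) v).withDensity fun y => ∏ n, ENNReal.ofReal
        (gaussianPDFReal 0 w (y n) / gaussianPDFReal (a n) v (y n)) := by
    have : ∀ n : Fin N, SigmaFinite ((gaussianReal (a n) v).withDensity fun x =>
        ENNReal.ofReal (gaussianPDFReal 0 w x / gaussianPDFReal (a n) v x)) := fun n => by
      rw [gaussianReal_withDensity_div (a n) hv hw]; infer_instance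
    rw [← pi_withDensity _ hmeas]
    simp_rw [gaussianReal_withDensity_div _ hv hw]
  rw [hdens, lintegral_withDensity_eq_lintegral_mul _ hprod hF,
    ← hshift.lintegral_comp (hprod.mul hF)]
  simp [mul_comm]

theorem log_gaussianPDFReal (m : ℝ) {v : ℝ≥0} (hv : v ≠ 0) (x : ℝ) :
    Real.log (gaussianPDFReal m v x) =
      -(1 / 2) * Real.log (2 * Real.pi * v) - (x - m) ^ 2 / (2 * v) := by
  have hv' : (0 : ℝ) < v := by positivity
  rw [gaussianPDFReal, Real.log_mul (by positivity) (Real.exp_pos _).ne', Real.log_inv,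
    Real.log_sqrt (by positivity), Real.log_exp]
  ring

/-! ### The information-theoretic bound -/

instance : IsProbabilityMeasure unif := ⟨by simp [unif]; norm_num⟩

instance (ν : Measure ℝ) [IsProbabilityMeasure ν] (M : ℕ) :
    IsProbabilityMeasure (sourceLaw ν M) := by
  unfold sourceLaw; infer_instance

instance (σ : ℝ≥0) (N : ℕ) : IsProbabilityMeasure (noiseLaw σ N) := by
  unfold noiseLaw; infer_instance

/-- Gibbs' inequality, in the form of Jensen's inequality for the logarithm. -/
theorem integral_log_nonpos {Ω : Type*} [MeasurableSpace Ω] {μ : Measure Ω}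
    [IsProbabilityMeasure μ] {R : Ω → ℝ} (hR : Measurable R) (hpos : ∀ ω, 0 < R ω)
    (hle : ∫⁻ ω, ENNReal.ofReal (R ω) ∂μ ≤ 1) (hint : Integrable (fun ω => Real.log (R ω)) μ) :
    ∫ ω, Real.log (R ω) ∂μ ≤ 0 := by
  have hRint : Integrable R μ :=
    (lintegral_ofReal_ne_top_iff_integrable hR.aestronglyMeasurable
      (ae_of_all _ fun ω => (hpos ω).le)).1 (hle.trans_lt ENNReal.one_lt_top).ne
  have hR1 : ∫ ω, R ω ∂μ ≤ 1 := by
    rw [integral_eq_lintegral_of_nonneg_ae (ae_of_all _ fun ω => (hpos ω).le)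
      hR.aestronglyMeasurable]
    exact ENNReal.toReal_le_of_le_ofReal zero_le_one (by simpa using hle)
  calc ∫ ω, Real.log (R ω) ∂μ ≤ ∫ ω, (R ω - 1) ∂μ :=
        integral_mono hint (hRint.sub (integrable_const _))
          fun ω => Real.log_le_sub_one_of_pos (hpos ω)
    _ = ∫ ω, R ω ∂μ - 1 := by rw [integral_sub hRint (integrable_const _)]; simp
    _ ≤ 0 := by linarith

variable {N : ℕ}

/-- The reconstruction error as a function of the source and the noise. -/
def Scheme.err (S : Scheme 1 N) (p : (Fin 1 → ℝ) × (Fin N → ℝ)) : ℝ :=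
  p.1 0 - S.dec (fun n => S.enc n p.1 + p.2 n) 0

theorem Scheme.measurable_output (S : Scheme 1 N) :
    Measurable fun p : (Fin 1 → ℝ) × (Fin N → ℝ) => fun n => S.enc n p.1 + p.2 n :=
  measurable_pi_lambda _ fun n => ((S.measurable_enc n).comp measurable_fst).add
    ((measurable_pi_apply n).comp measurable_snd)

theorem Scheme.measurable_err (S : Scheme 1 N) : Measurable S.err :=
  ((measurable_pi_apply 0).comp measurable_fst).sub
    ((measurable_pi_apply 0).comp (S.measurable_dec.comp S.measurable_output))

theorem Scheme.distortion_eq (S : Scheme 1 N) (ν : Measure ℝ) (σ : ℝ≥0) :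
    S.distortion ν σ =
      ∫⁻ p, ENNReal.ofReal (S.err p ^ 2) ∂((sourceLaw ν 1).prod (noiseLaw σ N)) := by
  refine lintegral_congr fun p => ?_
  simp [Scheme.err, sub_sq_comm]

/-- The ratio between the subdensity
`u, y ↦ gaussianPDFReal (ψ y) d u * ∏ₙ gaussianPDFReal 0 w (yₙ)` and the joint density of source
and channel output, evaluated at the source `p.1` and the noise `p.2`. -/
noncomputable def Scheme.ratio (S : Scheme 1 N) (v w d : ℝ≥0)
    (p : (Fin 1 → ℝ) × (Fin N → ℝ)) : ℝ :=
  gaussianPDFReal 0 d (S.err p) *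
    ∏ n, (gaussianPDFReal 0 w (S.enc n p.1 + p.2 n) /
      gaussianPDFReal (S.enc n p.1) v (S.enc n p.1 + p.2 n))

theorem Scheme.ratio_pos (S : Scheme 1 N) {v w d : ℝ≥0} (hv : v ≠ 0) (hw : w ≠ 0) (hd : d ≠ 0)
    (p : (Fin 1 → ℝ) × (Fin N → ℝ)) : 0 < S.ratio v w d p :=
  mul_pos (gaussianPDFReal_pos _ _ _ hd) (Finset.prod_pos fun _ _ =>
    div_pos (gaussianPDFReal_pos _ _ _ hw) (gaussianPDFReal_pos _ _ _ hv))

theorem Scheme.measurable_ratio (S : Scheme 1 N) (v w d : ℝ≥0) :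
    Measurable (S.ratio v w d) := by
  have hy : ∀ n, Measurable fun p : (Fin 1 → ℝ) × (Fin N → ℝ) => S.enc n p.1 + p.2 n :=
    fun n => (measurable_pi_apply n).comp S.measurable_output
  refine ((measurable_gaussianPDFReal 0 d).comp S.measurable_err).mul
    (Finset.measurable_prod _ fun n _ =>
      ((measurable_gaussianPDFReal 0 w).comp (hy n)).div ?_)
  exact measurable_uncurry_gaussianPDFReal.comp
    (((S.measurable_enc n).comp measurable_fst).prodMk (measurable_const.prodMk (hy n)))

/-- The expected ratio is the total mass of the subdensity over the source interval. Integrating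
over the source first, for a fixed output, it is at most that of a Gaussian density. -/
theorem Scheme.lintegral_ratio_le (S : Scheme 1 N) {σ w d : ℝ≥0} (hσ : σ ≠ 0) (hw : w ≠ 0)
    (hd : d ≠ 0) :
    ∫⁻ p, ENNReal.ofReal (S.ratio (σ ^ 2) w d p)
      ∂((sourceLaw unif 1).prod (noiseLaw σ N)) ≤ 1 := by
  have hσ2 : σ ^ 2 ≠ 0 := pow_ne_zero 2 hσ
  have hdec : Measurable fun y => S.dec y 0 := (measurable_pi_apply 0).comp S.measurable_dec
  have hK : Measurable fun q : ℝ × (Fin N → ℝ) => gaussianPDF 0 d (q.1 - S.dec q.2 0) :=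
    (measurable_gaussianPDF 0 d).comp (measurable_fst.sub (hdec.comp measurable_snd))
  rw [lintegral_prod _ (S.measurable_ratio _ _ _).ennreal_ofReal.aemeasurable]
  have hinner : ∀ u, ∫⁻ z, ENNReal.ofReal (S.ratio (σ ^ 2) w d (u, z)) ∂(noiseLaw σ N) =
      ∫⁻ y, gaussianPDF 0 d (u 0 - S.dec y 0) ∂(Measure.pi fun _ => gaussianReal 0 w) := by
    intro u
    have hu : Measurable fun y => gaussianPDF 0 d (u 0 - S.dec y 0) :=
      (measurable_gaussianPDF 0 d).comp (hdec.const_sub _)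
    rw [← lintegral_shift_mul_likelihoodRatio (fun n => S.enc n u) hσ2 hw hu]
    refine lintegral_congr fun z => ?_
    rw [Scheme.ratio, ENNReal.ofReal_mul (gaussianPDFReal_nonneg _ _ _),
      ENNReal.ofReal_prod_of_nonneg fun n _ =>
        div_nonneg (gaussianPDFReal_nonneg _ _ _) (gaussianPDFReal_nonneg _ _ _)]
    rfl
  simp_rw [hinner]
  have hout : Measurable fun x : ℝ => ∫⁻ y, gaussianPDF 0 d (x - S.dec y 0)
      ∂(Measure.pi fun _ : Fin N => gaussianReal 0 w) := hK.lintegral_prod_right'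
  have hmp : MeasurePreserving (Function.eval 0) (sourceLaw unif 1) unif :=
    measurePreserving_eval _ 0
  calc ∫⁻ u, ∫⁻ y, gaussianPDF 0 d (u 0 - S.dec y 0)
        ∂(Measure.pi fun _ : Fin N => gaussianReal 0 w) ∂(sourceLaw unif 1)
      = ∫⁻ x, ∫⁻ y, gaussianPDF 0 d (x - S.dec y 0)
        ∂(Measure.pi fun _ : Fin N => gaussianReal 0 w) ∂unif := hmp.lintegral_comp hout
    _ ≤ ∫⁻ x : ℝ, ∫⁻ y, gaussianPDF 0 d (x - S.dec y 0)
        ∂(Measure.pi fun _ : Fin N => gaussianReal 0 w) :=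
        lintegral_mono' Measure.restrict_le_self le_rfl
    _ = ∫⁻ y, (∫⁻ x : ℝ, gaussianPDF 0 d (x - S.dec y 0))
        ∂(Measure.pi fun _ : Fin N => gaussianReal 0 w) :=
        lintegral_lintegral_swap hK.aemeasurable
    _ = 1 := by
        simp [lintegral_sub_right_eq_self (gaussianPDF 0 d), lintegral_gaussianPDF_eq_one 0 hd]

theorem Scheme.log_ratio (S : Scheme 1 N) {v w d : ℝ≥0} (hv : v ≠ 0) (hw : w ≠ 0) (hd : d ≠ 0)
    (p : (Fin 1 → ℝ) × (Fin N → ℝ)) :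
    Real.log (S.ratio v w d p) = -(1 / 2) * Real.log (2 * Real.pi * d) - S.err p ^ 2 / (2 * d) +
      ∑ n, ((1 / 2) * Real.log (v / w) - (S.enc n p.1 + p.2 n) ^ 2 / (2 * w) +
        p.2 n ^ 2 / (2 * v)) := by
  have hv' : (0 : ℝ) < v := by positivity
  have hw' : (0 : ℝ) < w := by positivity
  rw [Scheme.ratio, Real.log_mul (gaussianPDFReal_pos _ _ _ hd).ne'
    (Finset.prod_pos fun _ _ =>
      div_pos (gaussianPDFReal_pos _ _ _ hw) (gaussianPDFReal_pos _ _ _ hv)).ne',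
    Real.log_prod fun _ _ =>
      (div_pos (gaussianPDFReal_pos _ _ _ hw) (gaussianPDFReal_pos _ _ _ hv)).ne',
    log_gaussianPDFReal 0 hd, sub_zero]
  congr 1
  refine Finset.sum_congr rfl fun n _ => ?_
  rw [Real.log_div (gaussianPDFReal_pos _ _ _ hw).ne' (gaussianPDFReal_pos _ _ _ hv).ne',
    log_gaussianPDFReal 0 hw, log_gaussianPDFReal _ hv, Real.log_div hv'.ne' hw'.ne',
    Real.log_mul (by positivity) hw'.ne', Real.log_mul (by positivity) hv'.ne',
    add_sub_cancel_left, sub_zero]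
  ring

theorem integrable_sq_gaussianReal (v : ℝ≥0) :
    Integrable (fun x => x ^ 2) (gaussianReal 0 v) :=
  (memLp_id_gaussianReal 2).integrable_sq

theorem integral_sq_gaussianReal (v : ℝ≥0) : ∫ x, x ^ 2 ∂(gaussianReal 0 v) = v := by
  have h := variance_eq_integral (μ := gaussianReal 0 v) (X := id) aemeasurable_id
  simpa using h.symm

/-- The second moment of the channel output `a(U) + Z` is the sum of the second moments of `a(U)`
and `Z`. -/
theorem integral_add_noise_sq {Ω : Type*} [MeasurableSpace Ω] {μ : Measure Ω}
    [IsProbabilityMeasure μ] {a : Ω → ℝ} (ha : MemLp a 2 μ) (σ : ℝ≥0) (n : Fin N) :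
    Integrable (fun p : Ω × (Fin N → ℝ) => (a p.1 + p.2 n) ^ 2) (μ.prod (noiseLaw σ N)) ∧
      ∫ p, (a p.1 + p.2 n) ^ 2 ∂(μ.prod (noiseLaw σ N)) = ∫ u, a u ^ 2 ∂μ + σ ^ 2 := by
  have hmp : MeasurePreserving (Function.eval n) (noiseLaw σ N) (gaussianReal 0 (σ ^ 2)) :=
    measurePreserving_eval _ n
  have hz2 : Integrable (fun z : Fin N → ℝ => z n ^ 2) (noiseLaw σ N) :=
    hmp.integrable_comp_of_integrable (integrable_sq_gaussianReal _)
  have hz1 : Integrable (fun z : Fin N → ℝ => z n) (noiseLaw σ N) :=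
    hmp.integrable_comp_of_integrable ((memLp_id_gaussianReal 1).integrable le_rfl)
  have hz2i : ∫ z, z n ^ 2 ∂(noiseLaw σ N) = σ ^ 2 := by
    have h := integral_map hmp.measurable.aemeasurable (μ := noiseLaw σ N)
      (f := fun x : ℝ => x ^ 2) (by fun_prop)
    rw [hmp.map_eq, integral_sq_gaussianReal] at h
    simpa using h.symm
  have hz1i : ∫ z, z n ∂(noiseLaw σ N) = 0 := by
    have h := integral_map hmp.measurable.aemeasurable (μ := noiseLaw σ N)
      (f := fun x : ℝ => x) (by fun_prop)
    rw [hmp.map_eq, integral_id_gaussianReal] at h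
    exact h.symm
  have h1 : Integrable (fun p : Ω × (Fin N → ℝ) => a p.1 ^ 2) (μ.prod (noiseLaw σ N)) :=
    ha.integrable_sq.comp_fst _
  have h2 : Integrable (fun p : Ω × (Fin N → ℝ) => a p.1 * p.2 n) (μ.prod (noiseLaw σ N)) :=
    (ha.integrable one_le_two).mul_prod hz1
  have h3 : Integrable (fun p : Ω × (Fin N → ℝ) => p.2 n ^ 2) (μ.prod (noiseLaw σ N)) :=
    hz2.comp_snd _
  have hexp : (fun p : Ω × (Fin N → ℝ) => (a p.1 + p.2 n) ^ 2) =
      fun p => a p.1 ^ 2 + 2 * (a p.1 * p.2 n) + p.2 n ^ 2 := by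
    ext p; ring
  have h12 : Integrable (fun p : Ω × (Fin N → ℝ) => a p.1 ^ 2 + 2 * (a p.1 * p.2 n))
    (μ.prod (noiseLaw σ N)) := h1.add (h2.const_mul 2)
  rw [hexp]
  refine ⟨h12.add h3, ?_⟩
  rw [integral_add h12 h3, integral_add h1 (h2.const_mul 2),
    integral_const_mul, integral_prod_mul a (fun z : Fin N → ℝ => z n), hz1i,
    integral_fun_fst (fun u => a u ^ 2), integral_fun_snd (fun z : Fin N → ℝ => z n ^ 2), hz2i]
  simp

theorem Scheme.integral_enc_sq_le (hN : 1 ≤ N) (S : Scheme 1 N) {ν : Measure ℝ} {P : ℝ≥0}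
    (hP : S.power ν ≤ P) :
    (∀ n, MemLp (S.enc n) 2 (sourceLaw ν 1)) ∧
      ∑ n, ∫ u, S.enc n u ^ 2 ∂(sourceLaw ν 1) ≤ N * P := by
  have hN0 : (0 : ℝ) < N := by exact_mod_cast hN
  have hmeas : Measurable fun u => (1 / (N : ℝ)) * ∑ n, S.enc n u ^ 2 :=
    (Finset.measurable_sum _ fun n _ => (S.measurable_enc n).pow_const 2).const_mul _
  have hnn : ∀ u, 0 ≤ (1 / (N : ℝ)) * ∑ n, S.enc n u ^ 2 := fun u => by positivity
  have hint : Integrable (fun u => (1 / (N : ℝ)) * ∑ n, S.enc n u ^ 2) (sourceLaw ν 1) :=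
    (lintegral_ofReal_ne_top_iff_integrable hmeas.aestronglyMeasurable (ae_of_all _ hnn)).1
      (hP.trans_lt ENNReal.coe_lt_top).ne
  have hmem : ∀ n, Integrable (fun u => S.enc n u ^ 2) (sourceLaw ν 1) := by
    intro n
    refine (hint.const_mul (N : ℝ)).mono' ((S.measurable_enc n).pow_const 2).aestronglyMeasurable
      (ae_of_all _ fun u => ?_)
    rw [Real.norm_of_nonneg (sq_nonneg _), ← mul_assoc, mul_one_div_cancel hN0.ne', one_mul]
    exact Finset.single_le_sum (f := fun n => S.enc n u ^ 2) (fun _ _ => sq_nonneg _)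
      (Finset.mem_univ n)
  refine ⟨fun n => (memLp_two_iff_integrable_sq
    (S.measurable_enc n).aestronglyMeasurable).2 (hmem n), ?_⟩
  have hle : ∫ u, (1 / (N : ℝ)) * ∑ n, S.enc n u ^ 2 ∂(sourceLaw ν 1) ≤ P := by
    rw [integral_eq_lintegral_of_nonneg_ae (ae_of_all _ hnn) hmeas.aestronglyMeasurable]
    exact ENNReal.toReal_le_of_le_ofReal P.2 (by simpa [Scheme.power] using hP)
  rw [integral_const_mul, integral_finsetSum _ fun n _ => hmem n, one_div_mul_eq_div,
    div_le_iff₀ hN0] at hle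
  linarith

/-- The information-theoretic lower bound on the distortion: `1 / (2πe) ≤ d (1 + P/σ²)^N`. -/
theorem Scheme.Achieves.one_le (hN : 1 ≤ N) {S : Scheme 1 N} {σ P d : ℝ≥0} (hσ : 0 < σ)
    (hd : 0 < d) (h : S.Achieves unif σ P d) :
    1 ≤ 2 * Real.pi * Real.exp 1 * d * (1 + snr P σ) ^ N := by
  obtain ⟨hpow, hdist⟩ := h
  obtain ⟨hmem, hsum⟩ := S.integral_enc_sq_le hN hpow
  set w : ℝ≥0 := P + σ ^ 2 with hw
  have hσ' : (0 : ℝ) < σ := hσ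
  have hd' : (0 : ℝ) < d := hd
  have hw0 : (0 : ℝ≥0) < w := by positivity
  have hw' : (0 : ℝ) < w := hw0
  have hv0 : (0 : ℝ≥0) < σ ^ 2 := by positivity
  have hv' : (0 : ℝ) < (σ ^ 2 : ℝ≥0) := hv0
  set μ := (sourceLaw unif 1).prod (noiseLaw σ N) with hμ
  rw [S.distortion_eq] at hdist
  have herr : Integrable (fun p => S.err p ^ 2) μ :=
    (lintegral_ofReal_ne_top_iff_integrable (S.measurable_err.pow_const 2).aestronglyMeasurable
      (ae_of_all _ fun _ => sq_nonneg _)).1 (hdist.trans_lt ENNReal.coe_lt_top).ne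
  have herr_le : ∫ p, S.err p ^ 2 ∂μ ≤ d := by
    rw [integral_eq_lintegral_of_nonneg_ae (ae_of_all _ fun _ => sq_nonneg _)
      (S.measurable_err.pow_const 2).aestronglyMeasurable]
    exact ENNReal.toReal_le_of_le_ofReal d.2 (by simpa using hdist)
  have hy := fun n => integral_add_noise_sq (hmem n) σ n
  have hz : ∀ n : Fin N, Integrable (fun p : (Fin 1 → ℝ) × (Fin N → ℝ) => p.2 n ^ 2) μ ∧
      ∫ p, p.2 n ^ 2 ∂μ = σ ^ 2 := fun n => by
    simpa using integral_add_noise_sq (μ := sourceLaw unif 1) (a := fun _ => 0) (by simp) σ n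
  have hterm_sub : ∀ n, Integrable (fun p : (Fin 1 → ℝ) × (Fin N → ℝ) =>
      (1 / 2) * Real.log ((σ ^ 2 : ℝ≥0) / w) - (S.enc n p.1 + p.2 n) ^ 2 / (2 * w)) μ :=
    fun n => (integrable_const _).sub ((hy n).1.div_const _)
  have hterm : ∀ n, Integrable (fun p : (Fin 1 → ℝ) × (Fin N → ℝ) =>
      (1 / 2) * Real.log ((σ ^ 2 : ℝ≥0) / w) - (S.enc n p.1 + p.2 n) ^ 2 / (2 * w) +
        p.2 n ^ 2 / (2 * (σ ^ 2 : ℝ≥0))) μ := fun n =>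
    (hterm_sub n).add ((hz n).1.div_const _)
  have hhead : Integrable (fun p => -(1 / 2) * Real.log (2 * Real.pi * d) -
      S.err p ^ 2 / (2 * d)) μ := (integrable_const _).sub (herr.div_const _)
  have hlog := integral_log_nonpos (S.measurable_ratio (σ ^ 2) w d)
    (S.ratio_pos hv0.ne' hw0.ne' hd.ne') (S.lintegral_ratio_le hσ.ne' hw0.ne' hd.ne')
    (by
      simp_rw [S.log_ratio hv0.ne' hw0.ne' hd.ne']
      exact hhead.add (integrable_finsetSum _ fun n _ => hterm n))
  simp_rw [S.log_ratio hv0.ne' hw0.ne' hd.ne'] at hlog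
  rw [integral_add hhead (integrable_finsetSum _ fun n _ => hterm n),
    integral_finsetSum _ fun n _ => hterm n,
    integral_sub (integrable_const _) (herr.div_const _), integral_div] at hlog
  have hterm_eq : ∀ n, ∫ p, ((1 / 2) * Real.log ((σ ^ 2 : ℝ≥0) / w) -
      (S.enc n p.1 + p.2 n) ^ 2 / (2 * w) + p.2 n ^ 2 / (2 * (σ ^ 2 : ℝ≥0))) ∂μ =
      (1 / 2) * Real.log ((σ ^ 2 : ℝ≥0) / w) -
        (∫ u, S.enc n u ^ 2 ∂(sourceLaw unif 1) + σ ^ 2) / (2 * w) + 1 / 2 := by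
    intro n
    rw [integral_add (hterm_sub n) ((hz n).1.div_const _),
      integral_sub (integrable_const _) ((hy n).1.div_const _), integral_div, integral_div,
      (hz n).2, (hy n).2]
    simp
    field_simp
  simp_rw [hterm_eq] at hlog
  have hsnr : 1 + snr P σ = w / (σ ^ 2 : ℝ≥0) := by
    rw [snr, hw]; push_cast; field_simp; ring
  have hloginv : Real.log ((σ ^ 2 : ℝ≥0) / w) = -Real.log (1 + snr P σ) := by
    rw [hsnr, ← Real.log_inv, inv_div]
  have hpw : ∑ n, (∫ u, S.enc n u ^ 2 ∂(sourceLaw unif 1) + (σ : ℝ) ^ 2) / (2 * (w : ℝ)) ≤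
      (N : ℝ) / 2 := by
    rw [← Finset.sum_div, Finset.sum_add_distrib, div_le_iff₀ (by positivity)]
    have : (w : ℝ) = P + σ ^ 2 := by rw [hw]; push_cast; rfl
    simp [this]
    linarith
  have hde : (∫ p, S.err p ^ 2 ∂μ) / (2 * d) ≤ 1 / 2 := by
    rw [div_le_iff₀ (by positivity)]; linarith
  rw [Finset.sum_add_distrib, Finset.sum_sub_distrib, hloginv] at hlog
  simp at hlog
  have hs0 : 0 < 1 + snr P σ := by rw [hsnr]; positivity
  have hfin : 0 ≤ Real.log (2 * Real.pi * Real.exp 1 * d * (1 + snr P σ) ^ N) := by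
    rw [Real.log_mul (by positivity) (by positivity), Real.log_pow,
      show 2 * Real.pi * Real.exp 1 * d = 2 * Real.pi * d * Real.exp 1 by ring,
      Real.log_mul (by positivity) (by positivity), Real.log_exp]
    linarith
  exact (Real.log_nonneg_iff (by positivity)).1 hfin

/-! ### A digit expansion with gaps at every scale -/

/-- The weight of the `k`-th binary digit, `2⁻ᵏ (1 + 1 / (k + 1))`. It exceeds the sum of all later
weights. -/
noncomputable def digitWeight (k : ℕ) : ℝ := (1 / 2) ^ k * ((k + 2) / (k + 1))

/-- A lower bound for the distance of two expansions whose first difference is at the `k`-th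
digit. -/
noncomputable def digitGap (k : ℕ) : ℝ := (1 / 2) ^ k / ((k + 1) * (k + 2))

theorem digitWeight_nonneg (k : ℕ) : 0 ≤ digitWeight k := by
  unfold digitWeight; positivity

theorem digitGap_antitone : Antitone digitGap := by
  intro i j hij
  unfold digitGap
  gcongr ?_ / ((?_ + 1) * (?_ + 2))
  · exact pow_le_pow_of_le_one (by norm_num) (by norm_num) hij
  · exact_mod_cast hij
  · exact_mod_cast hij

theorem digitWeight_add_le (k i : ℕ) :
    digitWeight (i + k) ≤ (1 / 2) ^ i * ((1 / 2) ^ k * ((k + 2) / (k + 1))) := by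
  rw [digitWeight, pow_add, mul_assoc]
  gcongr ?_ * (?_ * ?_)
  rw [div_le_div_iff₀ (by positivity) (by positivity)]
  push_cast
  nlinarith [(Nat.cast_nonneg i : (0 : ℝ) ≤ i)]

theorem summable_digitWeight : Summable digitWeight := by
  refine Summable.of_nonneg_of_le digitWeight_nonneg (fun i => digitWeight_add_le 0 i) ?_
  exact summable_geometric_two.mul_right _

theorem tsum_digitWeight_add_le (k : ℕ) :
    ∑' i, digitWeight (i + k) ≤ 2 * ((1 / 2) ^ k * ((k + 2) / (k + 1))) := by
  have h2 := tsum_mul_right (L := .unconditional ℕ) (f := fun i : ℕ => (1 / 2 : ℝ) ^ i)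
    (a := (1 / 2) ^ k * (((k : ℝ) + 2) / (k + 1)))
  rw [tsum_geometric_two] at h2
  rw [← h2]
  exact ((summable_nat_add_iff k).2 summable_digitWeight).tsum_le_tsum (digitWeight_add_le k)
    (summable_geometric_two.mul_right _)

theorem tsum_digitWeight_succ_le (k : ℕ) :
    ∑' i, digitWeight (i + (k + 1)) ≤ digitWeight k - digitGap k := by
  refine (tsum_digitWeight_add_le (k + 1)).trans_eq ?_
  rw [digitWeight, digitGap, pow_succ]
  push_cast
  field_simp
  ring

theorem summable_digitWeight_mul {e : ℕ → ℝ} (he : ∀ i, |e i| ≤ 1) :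
    Summable fun i => digitWeight i * e i := by
  refine summable_digitWeight.of_norm_bounded fun i => ?_
  rw [Real.norm_eq_abs, abs_mul, abs_of_nonneg (digitWeight_nonneg i)]
  exact mul_le_of_le_one_right (digitWeight_nonneg i) (he i)

/-- If the first nonzero term of a difference of digit sequences is `1`, then later terms cannot
bring the difference of the expansions below the gap. -/
theorem digitGap_le_tsum {e : ℕ → ℝ} (he : ∀ i, |e i| ≤ 1) {k : ℕ} (hzero : ∀ i < k, e i = 0)
    (hone : e k = 1) : digitGap k ≤ ∑' i, digitWeight i * e i := by
  have hs := summable_digitWeight_mul he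
  have hs' := (summable_nat_add_iff (k + 1)).2 hs
  have ha := (summable_nat_add_iff (k + 1)).2 summable_digitWeight
  rw [← hs.sum_add_tsum_nat_add (k + 1), Finset.sum_range_succ,
    Finset.sum_eq_zero fun i hi => by rw [hzero i (Finset.mem_range.1 hi), mul_zero], hone]
  have : -∑' i, digitWeight (i + (k + 1)) ≤
      ∑' i, digitWeight (i + (k + 1)) * e (i + (k + 1)) := by
    rw [← tsum_neg]
    refine ha.neg.tsum_le_tsum (fun i => ?_) hs'
    nlinarith [digitWeight_nonneg (i + (k + 1)), (abs_le.1 (he (i + (k + 1)))).1]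
  linarith [tsum_digitWeight_succ_le k]

/-- The number with binary digit sequence `d`, in the expansion with gaps. -/
noncomputable def gapExpansion (d : ℕ → Fin 2) : ℝ := ∑' k, digitWeight k * (d k : ℕ)

theorem abs_digit_le_one (a : Fin 2) : |((a : ℕ) : ℝ)| ≤ 1 := by
  fin_cases a <;> simp

theorem gapExpansion_mem (d : ℕ → Fin 2) : gapExpansion d ∈ Set.Icc (0 : ℝ) 4 := by
  refine ⟨tsum_nonneg fun k => mul_nonneg (digitWeight_nonneg k) (Nat.cast_nonneg _), ?_⟩
  have h := tsum_digitWeight_add_le 0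
  refine le_trans ?_ (h.trans (by norm_num))
  refine (summable_digitWeight_mul fun i => abs_digit_le_one (d i)).tsum_le_tsum (fun i => ?_)
    summable_digitWeight
  exact mul_le_of_le_one_right (digitWeight_nonneg i)
    ((le_abs_self _).trans (abs_digit_le_one (d i)))

/-- Expansions that are closer than the `K`-th gap have the same digits up to the `K`-th. -/
theorem digits_eq_of_abs_gapExpansion_sub_lt {d d' : ℕ → Fin 2} {K : ℕ}
    (h : |gapExpansion d - gapExpansion d'| < digitGap K) : ∀ k ≤ K, d k = d' k := by
  intro k
  induction k using Nat.strong_induction_on with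
  | _ k ih =>
    intro hk
    by_contra hne
    have hdiff : ∀ c c' : ℕ → Fin 2, ∀ i, |((c i : ℕ) : ℝ) - (c' i : ℕ)| ≤ 1 := by
      intro c c' i
      generalize c i = a
      generalize c' i = b
      fin_cases a <;> fin_cases b <;> simp
    have hsub : ∀ c c' : ℕ → Fin 2, gapExpansion c - gapExpansion c' =
        ∑' i, digitWeight i * (((c i : ℕ) : ℝ) - (c' i : ℕ)) := by
      intro c c'
      rw [gapExpansion, gapExpansion, ← (summable_digitWeight_mul fun i =>
        abs_digit_le_one (c i)).tsum_sub (summable_digitWeight_mul fun i =>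
        abs_digit_le_one (c' i))]
      simp_rw [mul_sub]
    have key : ∀ c c' : ℕ → Fin 2, (∀ i < k, c i = c' i) → c k = 1 → c' k = 0 →
        digitGap K ≤ gapExpansion c - gapExpansion c' := by
      intro c c' heq h1 h0
      rw [hsub]
      refine (digitGap_antitone hk).trans (digitGap_le_tsum (hdiff c c') (fun i hi => ?_) ?_)
      · rw [heq i hi, sub_self]
      · simp [h1, h0]
    have hlow : ∀ i < k, d i = d' i := fun i hi => ih i hi (hi.le.trans hk)
    obtain ⟨h1, h2⟩ := abs_lt.1 h
    have hcases : (d k = 1 ∧ d' k = 0) ∨ (d' k = 1 ∧ d k = 0) := by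
      revert hne
      generalize d k = a
      generalize d' k = b
      fin_cases a <;> fin_cases b <;> simp
    rcases hcases with ⟨ha, hb⟩ | ⟨ha, hb⟩
    · linarith [key d d' hlow ha hb]
    · linarith [key d' d (fun i hi => (hlow i hi).symm) ha hb]

/-! ### The digit-interleaving encoder -/

/-- The `n`-th channel input at unit power. The binary digits of `u + 1/2` are dealt out to the
`N` channel uses in turn, and each channel use expands its digits with gaps; expansions lie in
`[0, 4]`, whence the factor `1 / 4`. -/
noncomputable def interleave (n : Fin N) (u : Fin 1 → ℝ) : ℝ :=
  1 / 4 * gapExpansion fun k => Real.digits (u 0 + 1 / 2) 2 (k * N + n)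

theorem measurable_interleave (n : Fin N) : Measurable (interleave n) := by
  have hterm : ∀ k : ℕ, Measurable fun u : Fin 1 → ℝ =>
      digitWeight k * ((Real.digits (u 0 + 1 / 2) 2 (k * N + n) : ℕ) : ℝ) := by
    intro k
    have : Measurable fun u : Fin 1 → ℝ => ⌊(u 0 + 1 / 2) * (2 : ℕ) ^ (k * N + n + 1)⌋₊ :=
      Nat.measurable_floor.comp (((measurable_pi_apply 0).add_const _).mul_const _)
    exact ((measurable_from_top (f := fun m : ℕ => ((Fin.ofNat 2 m : ℕ) : ℝ))).comp
      this).const_mul _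
  refine Measurable.const_mul ?_ _
  exact measurable_of_tendsto_metrizable
    (fun K => Finset.measurable_sum (Finset.range K) fun k _ => hterm k)
    (tendsto_pi_nhds.2 fun u => by
      simpa [gapExpansion] using (summable_digitWeight_mul (e := fun k =>
        ((Real.digits (u 0 + 1 / 2) 2 (k * N + n) : ℕ) : ℝ))
        fun i => abs_digit_le_one _).hasSum.tendsto_sum_nat)

theorem interleave_sq_le_one (n : Fin N) (u : Fin 1 → ℝ) : interleave n u ^ 2 ≤ 1 := by
  obtain ⟨h0, h4⟩ := gapExpansion_mem fun k => Real.digits (u 0 + 1 / 2) 2 (k * N + n)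
  unfold interleave
  nlinarith

/-- Sources whose images are close in every channel use share their leading binary digits. -/
theorem floor_eq_of_abs_interleave_sub_lt (hN : 1 ≤ N) {u u' : Fin 1 → ℝ} {K : ℕ}
    (hu : u 0 + 1 / 2 ∈ Set.Ico (0 : ℝ) 1) (hu' : u' 0 + 1 / 2 ∈ Set.Ico (0 : ℝ) 1)
    (h : ∀ n : Fin N, |interleave n u - interleave n u'| < digitGap K / 4) :
    ⌊2 ^ (N * (K + 1)) * (u 0 + 1 / 2)⌋₊ = ⌊2 ^ (N * (K + 1)) * (u' 0 + 1 / 2)⌋₊ := by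
  have hdig : ∀ i < N * (K + 1),
      Real.digits (u 0 + 1 / 2) 2 i = Real.digits (u' 0 + 1 / 2) 2 i := by
    intro i hi
    have hlt : i % N < N := Nat.mod_lt _ hN
    have hn := h ⟨i % N, hlt⟩
    rw [interleave, interleave, ← mul_sub, abs_mul, abs_of_pos (by norm_num)] at hn
    have := digits_eq_of_abs_gapExpansion_sub_lt (K := K) (by linarith) (i / N)
      (Nat.lt_succ_iff.1 (Nat.div_lt_of_lt_mul hi))
    simpa [Nat.div_add_mod'] using this
  have e1 := Real.ofDigits_digits_sum_eq (b := 2) hu (N * (K + 1))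
  have e2 := Real.ofDigits_digits_sum_eq (b := 2) hu' (N * (K + 1))
  have : ∑ i ∈ Finset.range (N * (K + 1)),
        Real.ofDigitsTerm (Real.digits (u 0 + 1 / 2) 2) i =
      ∑ i ∈ Finset.range (N * (K + 1)),
        Real.ofDigitsTerm (Real.digits (u' 0 + 1 / 2) 2) i :=
    Finset.sum_congr rfl fun i hi => by
      rw [Real.ofDigitsTerm, Real.ofDigitsTerm, hdig i (Finset.mem_range.1 hi)]
  rw [this, e2] at e1
  exact_mod_cast e1.symm

/-! ### The decoder and its distortion -/

/-- As long as the noise stays below half the `K`-th gap, the leading `N (K + 1)` binary digits of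
the source can be recovered by a measurable decoder. -/
theorem exists_decoder (hN : 1 ≤ N) {P ρ : ℝ} {K : ℕ} (hρ : 2 * ρ ≤ √P * (digitGap K / 4)) :
    ∃ ψ : (Fin N → ℝ) → ℝ, Measurable ψ ∧ (∀ y, ψ y ∈ Set.Icc (-(1 / 2) : ℝ) (1 / 2)) ∧
      ∀ u : Fin 1 → ℝ, u 0 + 1 / 2 ∈ Set.Ico (0 : ℝ) 1 → ∀ z : Fin N → ℝ, (∀ n, |z n| < ρ) →
        |ψ (fun n => √P * interleave n u + z n) - u 0| ≤ (1 / 2) ^ (N * (K + 1)) := by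
  set L := N * (K + 1) with hL
  -- The outputs that are compatible with the leading digits `m`: an open set.
  let B : ℕ → Set (Fin N → ℝ) := fun m =>
    ⋃ u ∈ {u : Fin 1 → ℝ | u 0 + 1 / 2 ∈ Set.Ico (0 : ℝ) 1 ∧ ⌊2 ^ L * (u 0 + 1 / 2)⌋₊ = m},
      ⋂ n, {y | |y n - √P * interleave n u| < ρ}
  have hB : ∀ m, MeasurableSet (B m) := fun m => by
    refine (isOpen_biUnion fun u _ => isOpen_iInter_of_finite fun n => ?_).measurableSet
    exact isOpen_lt (by fun_prop) continuous_const
  have hmem : ∀ {m y}, y ∈ B m → ∃ u : Fin 1 → ℝ, u 0 + 1 / 2 ∈ Set.Ico (0 : ℝ) 1 ∧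
      ⌊2 ^ L * (u 0 + 1 / 2)⌋₊ = m ∧ ∀ n, |y n - √P * interleave n u| < ρ := by
    intro m y hy
    simpa [B, and_assoc] using hy
  obtain ⟨ψ, hψ, hψB⟩ := exists_measurable_piecewise B hB
    (fun m _ => (m : ℝ) / 2 ^ L - 1 / 2) (fun _ => measurable_const) (by
      intro i j hij y hy
      obtain ⟨u, hu, rfl, huy⟩ := hmem hy.1
      obtain ⟨u', hu', rfl, huy'⟩ := hmem hy.2
      refine absurd (floor_eq_of_abs_interleave_sub_lt hN hu hu' fun n => ?_) hij
      have h1 := abs_lt.1 (huy n)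
      have h2 := abs_lt.1 (huy' n)
      have h3 : √P * |interleave n u - interleave n u'| < √P * (digitGap K / 4) := by
        rw [← abs_of_nonneg (Real.sqrt_nonneg P), ← abs_mul, abs_of_nonneg (Real.sqrt_nonneg P),
          mul_sub]
        exact (abs_lt.2 ⟨by linarith, by linarith⟩).trans_le hρ
      exact lt_of_mul_lt_mul_left h3 (Real.sqrt_nonneg P))
  refine ⟨fun y => max (-(1 / 2)) (min (ψ y) (1 / 2)), by fun_prop, fun y => ⟨le_max_left _ _,
    max_le (by norm_num) (min_le_right _ _)⟩, fun u hu z hz => ?_⟩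
  have hy : (fun n => √P * interleave n u + z n) ∈ B ⌊2 ^ L * (u 0 + 1 / 2)⌋₊ := by
    simp only [B, Set.mem_iUnion, Set.mem_iInter]
    exact ⟨u, ⟨hu, rfl⟩, fun n => by simpa using hz n⟩
  have hval := hψB _ hy
  have hpow : (0 : ℝ) < 2 ^ L := by positivity
  have hfl := Nat.floor_le (a := 2 ^ L * (u 0 + 1 / 2)) (mul_nonneg hpow.le hu.1)
  have hfl' := Nat.lt_floor_add_one (2 ^ L * (u 0 + 1 / 2))
  set m : ℝ := (⌊2 ^ L * (u 0 + 1 / 2)⌋₊ : ℝ)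
  have hm1 : m / 2 ^ L ≤ u 0 + 1 / 2 := by rw [div_le_iff₀ hpow]; linarith
  have hm2 : u 0 + 1 / 2 ≤ m / 2 ^ L + (1 / 2) ^ L := by
    rw [one_div_pow, ← add_div, le_div_iff₀ hpow]; linarith
  have hm0 : 0 ≤ m / 2 ^ L := by positivity
  have hu1 := hu.2
  simp only at hval ⊢
  rw [hval, min_eq_left (by linarith), max_eq_right (by linarith), abs_le]
  constructor <;> linarith

theorem gaussianReal_abs_ge_le {σ : ℝ≥0} {ρ : ℝ} (hρ : 0 ≤ ρ) :
    gaussianReal 0 (σ ^ 2) {x | ρ ≤ |x|} ≤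
      ENNReal.ofReal (2 * Real.exp (-ρ ^ 2 / (2 * σ ^ 2))) := by
  have hsub : HasSubgaussianMGF id (σ ^ 2) (gaussianReal 0 (σ ^ 2)) :=
    ⟨fun t => integrable_exp_mul_gaussianReal t, fun t => by rw [mgf_id_gaussianReal]; simp⟩
  have h1 := hsub.measure_ge_le hρ
  have h2 := hsub.neg.measure_ge_le hρ
  have hset : {x : ℝ | ρ ≤ |x|} = {x | ρ ≤ id x} ∪ {x | ρ ≤ (-id) x} := by
    ext x; simp [le_abs]
  rw [← ofReal_measureReal, hset]
  refine ENNReal.ofReal_le_ofReal ((measureReal_union_le _ _).trans ?_)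
  push_cast at h1 h2
  linarith

theorem noiseLaw_exists_ge_le {σ : ℝ≥0} {ρ : ℝ} (hρ : 0 ≤ ρ) :
    noiseLaw σ N {z | ∃ n, ρ ≤ |z n|} ≤
      ENNReal.ofReal (2 * N * Real.exp (-ρ ^ 2 / (2 * σ ^ 2))) := by
  have hset : {z : Fin N → ℝ | ∃ n, ρ ≤ |z n|} = ⋃ n, Function.eval n ⁻¹' {x | ρ ≤ |x|} := by
    ext z; simp
  have hmeas : MeasurableSet {x : ℝ | ρ ≤ |x|} := measurableSet_le (by fun_prop) (by fun_prop)
  rw [hset]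
  calc noiseLaw σ N (⋃ n, Function.eval n ⁻¹' {x | ρ ≤ |x|})
      ≤ ∑ n, noiseLaw σ N (Function.eval n ⁻¹' {x | ρ ≤ |x|}) := measure_iUnion_fintype_le _ _
    _ ≤ ∑ _n : Fin N, ENNReal.ofReal (2 * Real.exp (-ρ ^ 2 / (2 * σ ^ 2))) := by
        refine Finset.sum_le_sum fun n _ => ?_
        have hmp : MeasurePreserving (Function.eval n) (noiseLaw σ N) (gaussianReal 0 (σ ^ 2)) :=
          measurePreserving_eval _ n
        rw [hmp.measure_preimage hmeas.nullMeasurableSet]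
        exact gaussianReal_abs_ge_le hρ
    _ = ENNReal.ofReal (2 * N * Real.exp (-ρ ^ 2 / (2 * σ ^ 2))) := by
        rw [Finset.sum_const, Finset.card_univ, Fintype.card_fin, ← ENNReal.ofReal_nsmul,
          nsmul_eq_mul]
        congr 1; ring

/-- The right endpoint of the source interval, a null set, is excluded: binary digits are those of a
number in `[0, 1)`. -/
theorem ae_sourceLaw_unif : ∀ᵐ u ∂(sourceLaw unif 1), u 0 + 1 / 2 ∈ Set.Ico (0 : ℝ) 1 := by
  have hmp : MeasurePreserving (Function.eval 0) (sourceLaw unif 1) unif :=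
    measurePreserving_eval _ 0
  have h : ∀ᵐ x ∂unif, x + 1 / 2 ∈ Set.Ico (0 : ℝ) 1 := by
    have hne : ∀ᵐ x ∂unif, x ≠ 1 / 2 := by
      unfold unif; exact Measure.ae_ne _ _
    filter_upwards [ae_restrict_mem measurableSet_Icc, hne] with x hx hx'
    have := lt_of_le_of_ne hx.2 hx'
    exact ⟨by linarith [hx.1], by linarith⟩
  exact hmp.quasiMeasurePreserving.ae h

/-- The scheme with the interleaving encoder, scaled to the power `P`, and the decoder `ψ`. -/
noncomputable def interleaveScheme (P : ℝ) (ψ : (Fin N → ℝ) → ℝ) (hψ : Measurable ψ) :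
    Scheme 1 N where
  enc n u := √P * interleave n u
  dec y _ := ψ y
  measurable_enc n := (measurable_interleave n).const_mul _
  measurable_dec := measurable_pi_lambda _ fun _ => hψ

theorem interleaveScheme_power_le (P : ℝ≥0) (ψ : (Fin N → ℝ) → ℝ) (hψ : Measurable ψ) :
    (interleaveScheme P ψ hψ).power unif ≤ P := by
  have h : ∀ u : Fin 1 → ℝ,
      (1 / (N : ℝ)) * ∑ n, (interleaveScheme P ψ hψ).enc n u ^ 2 ≤ P := by
    intro u
    have hsum : ∑ n, (interleaveScheme P ψ hψ).enc n u ^ 2 ≤ ∑ _n : Fin N, (P : ℝ) := by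
      refine Finset.sum_le_sum fun n _ => ?_
      rw [interleaveScheme, mul_pow, Real.sq_sqrt P.coe_nonneg]
      exact mul_le_of_le_one_right P.coe_nonneg (interleave_sq_le_one n u)
    rw [Finset.sum_const, Finset.card_univ, Fintype.card_fin, nsmul_eq_mul] at hsum
    rcases Nat.eq_zero_or_pos N with rfl | hN
    · simp
    · rw [one_div_mul_eq_div, div_le_iff₀ (by exact_mod_cast hN)]
      linarith
  calc (interleaveScheme P ψ hψ).power unif ≤ ∫⁻ _, (P : ℝ≥0∞) ∂(sourceLaw unif 1) :=
        lintegral_mono fun u =>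
          (ENNReal.ofReal_le_ofReal (h u)).trans_eq (ENNReal.ofReal_coe_nnreal)
    _ = P := by simp

/-- If the decoder errs by at most `δ` when the noise is below `ρ`, the distortion is at most `δ²`
plus the probability of larger noise, in which case the squared error is still at most one. -/
theorem interleaveScheme_distortion_le (P σ : ℝ≥0) {ψ : (Fin N → ℝ) → ℝ}
    (hψ : Measurable ψ) (hψ' : ∀ y, ψ y ∈ Set.Icc (-(1 / 2) : ℝ) (1 / 2)) {ρ δ : ℝ} (hρ : 0 ≤ ρ)
    (hδ : ∀ u : Fin 1 → ℝ, u 0 + 1 / 2 ∈ Set.Ico (0 : ℝ) 1 → ∀ z : Fin N → ℝ, (∀ n, |z n| < ρ) →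
      |ψ (fun n => √(P : ℝ) * interleave n u + z n) - u 0| ≤ δ) :
    (interleaveScheme P ψ hψ).distortion unif σ ≤
      ENNReal.ofReal (δ ^ 2 + 2 * N * Real.exp (-ρ ^ 2 / (2 * σ ^ 2))) := by
  set μ := (sourceLaw unif 1).prod (noiseLaw σ N)
  set E : Set ((Fin 1 → ℝ) × (Fin N → ℝ)) := Prod.snd ⁻¹' {z | ∃ n, ρ ≤ |z n|} with hE
  have hEm : MeasurableSet {z : Fin N → ℝ | ∃ n, ρ ≤ |z n|} := by
    have : {z : Fin N → ℝ | ∃ n, ρ ≤ |z n|} = ⋃ n, {z | ρ ≤ |z n|} := by ext z; simp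
    rw [this]
    exact MeasurableSet.iUnion fun n => measurableSet_le (by fun_prop) (by fun_prop)
  have hsource : ∀ᵐ p ∂μ, p.1 0 + 1 / 2 ∈ Set.Ico (0 : ℝ) 1 :=
    measurePreserving_fst.quasiMeasurePreserving.ae ae_sourceLaw_unif
  rw [Scheme.distortion_eq]
  calc ∫⁻ p, ENNReal.ofReal ((interleaveScheme P ψ hψ).err p ^ 2) ∂μ
      ≤ ∫⁻ p, (ENNReal.ofReal (δ ^ 2) + E.indicator 1 p) ∂μ := by
        refine lintegral_mono_ae (hsource.mono fun p hp => ?_)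
        have herr : (interleaveScheme P ψ hψ).err p =
          p.1 0 - ψ (fun n => √(P : ℝ) * interleave n p.1 + p.2 n) := rfl
        by_cases hpE : p ∈ E
        · rw [Set.indicator_of_mem hpE]
          refine le_trans ?_ le_add_self
          refine ENNReal.ofReal_le_one.2 ?_
          obtain ⟨h1, h2⟩ := hψ' (fun n => √(P : ℝ) * interleave n p.1 + p.2 n)
          obtain ⟨h3, h4⟩ := hp
          rw [herr, sq_le_one_iff_abs_le_one, abs_le]
          constructor <;> linarith
        · refine le_trans (ENNReal.ofReal_le_ofReal ?_) le_self_add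
          have hz : ∀ n, |p.2 n| < ρ := by simpa [hE] using hpE
          rw [herr, sub_sq_comm]
          exact sq_le_sq.2 ((hδ p.1 hp p.2 hz).trans (le_abs_self _))
    _ = ENNReal.ofReal (δ ^ 2) + noiseLaw σ N {z | ∃ n, ρ ≤ |z n|} := by
        rw [lintegral_add_left measurable_const, lintegral_indicator_one (measurable_snd hEm),
          (measurePreserving_snd (μ := sourceLaw unif 1)).measure_preimage hEm.nullMeasurableSet]
        simp
    _ ≤ ENNReal.ofReal (δ ^ 2 + 2 * N * Real.exp (-ρ ^ 2 / (2 * σ ^ 2))) := by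
        rw [ENNReal.ofReal_add (by positivity) (by positivity)]
        gcongr
        exact noiseLaw_exists_ge_le hρ

/-! ### Choice of the resolution and asymptotics -/

theorem variance_unif : variance id unif = 1 / 12 := by
  have hmem : MemLp id 2 unif :=
    MemLp.of_bound aestronglyMeasurable_id (1 / 2) (by
      refine (ae_restrict_mem measurableSet_Icc).mono fun x hx => ?_
      exact abs_le.2 ⟨by simpa using hx.1, by simpa using hx.2⟩)
  have h1 : ∫ x, x ∂unif = 0 := by
    rw [unif, integral_Icc_eq_integral_Ioc,
      ← intervalIntegral.integral_of_le (by norm_num), integral_id]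
    norm_num
  have h2 : ∫ x, x ^ 2 ∂unif = 1 / 12 := by
    rw [unif, integral_Icc_eq_integral_Ioc,
      ← intervalIntegral.integral_of_le (by norm_num), integral_pow]
    norm_num
  rw [variance_eq_sub hmem]
  simp [h1, h2]

theorem lg_mul {x y : ℝ} (hx : x ≠ 0) (hy : y ≠ 0) : lg (x * y) = lg x + lg y :=
  Real.logb_mul hx hy

theorem lg_div {x y : ℝ} (hx : x ≠ 0) (hy : y ≠ 0) : lg (x / y) = lg x - lg y :=
  Real.logb_div hx hy

theorem lg_pow (x : ℝ) (n : ℕ) : lg (x ^ n) = n * lg x := Real.logb_pow 2 x n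

theorem lg_le_lg {x y : ℝ} (hx : 0 < x) (hxy : x ≤ y) : lg x ≤ lg y :=
  Real.logb_le_logb_of_le one_lt_two hx hxy

theorem tendsto_lg : Tendsto lg atTop atTop := Real.tendsto_logb_atTop one_lt_two

theorem eventually_lg_pow_four_le_sqrt : ∀ᶠ s : ℝ in atTop, lg s ^ 4 ≤ √s := by
  have h := (isLittleO_log_rpow_rpow_atTop (s := 1 / 2) 4 (by norm_num)).bound
    (c := Real.log 2 ^ 4) (by have := Real.log_pos one_lt_two; positivity)
  filter_upwards [h, eventually_ge_atTop 1] with s hs hs1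
  have hl := Real.log_nonneg hs1
  have hl2 := Real.log_pos one_lt_two
  rw [Real.norm_of_nonneg (by positivity), Real.norm_of_nonneg (by positivity),
    ← Real.sqrt_eq_rpow, show (4 : ℝ) = (4 : ℕ) by norm_num, Real.rpow_natCast] at hs
  rw [lg, Real.logb, div_pow, div_le_iff₀ (by positivity)]
  linarith

/-- The interleaving scheme at a signal-to-noise ratio `s = P/σ²` that is large enough. The
resolution `K` is the largest with `2 ^ K ≤ √s / (lg s) ^ 4`. Then the `K`-th gap exceeds
`σ √(2 N log s)`, which the noise exceeds with probability `O(s⁻ᴺ)`. -/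
theorem exists_interleaveScheme_distortion_le (hN : 1 ≤ N) {P σ : ℝ≥0} (hσ : 0 < σ) {s : ℝ}
    (hs : snr P σ = s) (hs1 : 1 < s) (ht : 2048 * N ≤ lg s) (hsqrt : lg s ^ 4 ≤ √s) :
    ∃ (ψ : (Fin N → ℝ) → ℝ) (hψ : Measurable ψ),
      (interleaveScheme P ψ hψ).distortion unif σ ≤
        ENNReal.ofReal ((1 + 2 * N) * lg s ^ (8 * N) / s ^ N) := by
  set t := lg s with ht_def
  have hN1 : (1 : ℝ) ≤ N := by exact_mod_cast hN
  have hs0 : 0 < s := zero_lt_one.trans hs1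
  have hσ' : (0 : ℝ) < σ := hσ
  have ht1 : 2048 ≤ t := by linarith
  have ht0 : 0 < t := by linarith
  have hr : 0 < √s := Real.sqrt_pos.2 hs0
  have hsq : √s ^ 2 = s := Real.sq_sqrt hs0.le
  have hq : 1 ≤ √s / t ^ 4 := by rwa [le_div_iff₀ (by positivity), one_mul]
  obtain ⟨K, hK1, hK2⟩ := exists_nat_pow_near hq one_lt_two
  have hKt : (K : ℝ) ≤ t := by
    have h1 : (2 : ℝ) ^ K ≤ s := by
      refine hK1.trans ((div_le_self hr.le (one_le_pow₀ (by linarith))).trans ?_)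
      rw [Real.sqrt_le_left hs0.le]
      nlinarith
    have h2 := lg_le_lg (by positivity) h1
    rwa [lg_pow, show lg 2 = 1 from Real.logb_self_eq_one one_lt_two, mul_one] at h2
  have hlog : Real.log s ≤ t := by
    have hl := Real.log_nonneg hs1.le
    rw [ht_def, lg, Real.logb, le_div_iff₀ (Real.log_pos one_lt_two)]
    nlinarith [Real.log_two_lt_d9]
  have hlog0 : 0 ≤ Real.log s := Real.log_nonneg hs1.le
  have hgap : t ^ 2 / 4 ≤ √s * digitGap K := by
    have h1 : (K + 1 : ℝ) * (K + 2) ≤ 4 * t ^ 2 := by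
      have : (0 : ℝ) ≤ K := Nat.cast_nonneg K
      nlinarith
    have h2 : t ^ 4 ≤ √s * (1 / 2) ^ K := by
      rw [le_div_iff₀ (by positivity)] at hK1
      rw [one_div_pow, mul_one_div, le_div_iff₀ (by positivity)]
      linarith
    rw [digitGap, ← mul_div_assoc, le_div_iff₀ (by positivity)]
    nlinarith [sq_nonneg t]
  -- The constant in `ht` makes `32 √(2 N t) ≤ t ^ 2`.
  have hnoise : 8 * √(2 * N * Real.log s) ≤ √s * digitGap K := by
    refine le_trans ?_ hgap
    have h1 : √(2 * N * Real.log s) ≤ t ^ 2 / 32 := by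
      refine Real.sqrt_le_iff.2 ⟨by positivity, ?_⟩
      have h2 : 2 * (N : ℝ) * Real.log s ≤ 2 * N * t := by gcongr
      have h3 : 2048 * N * t ≤ t * t := by gcongr
      have h4 : t * t ≤ t ^ 4 := by
        rw [← sq]; exact pow_le_pow_right₀ (by linarith) (by norm_num)
      nlinarith
    linarith
  -- At this noise radius, the Chernoff bound below evaluates to exactly `s⁻ᴺ`.
  set ρ := σ * √(2 * N * Real.log s) with hρ_def
  have hPs : √(P : ℝ) = σ * √s := by
    rw [← hs, snr, Real.sqrt_div P.coe_nonneg, Real.sqrt_sq hσ'.le]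
    field_simp
  have hρ : 2 * ρ ≤ √(P : ℝ) * (digitGap K / 4) := by
    rw [hρ_def, hPs]
    nlinarith
  obtain ⟨ψ, hψ, hψ1, hψ2⟩ := exists_decoder hN hρ
  refine ⟨ψ, hψ, (interleaveScheme_distortion_le P σ hψ hψ1 (by positivity) hψ2).trans
    (ENNReal.ofReal_le_ofReal ?_)⟩
  have hexp : Real.exp (-ρ ^ 2 / (2 * σ ^ 2)) = 1 / s ^ N := by
    have : -ρ ^ 2 / (2 * (σ : ℝ) ^ 2) = -(N * Real.log s) := by
      rw [hρ_def, mul_pow, Real.sq_sqrt (by positivity)]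
      field_simp
    rw [this, Real.exp_neg, mul_comm, Real.exp_mul, Real.exp_log hs0, Real.rpow_natCast, one_div]
  have hres : (((1 : ℝ) / 2) ^ (N * (K + 1))) ^ 2 ≤ t ^ (8 * N) / s ^ N := by
    have h1 : (1 / 2 : ℝ) ^ (K + 1) ≤ t ^ 4 / √s := by
      rw [one_div_pow, ← one_div_div (√s)]
      exact one_div_le_one_div_of_le (by positivity) hK2.le
    calc (((1 : ℝ) / 2) ^ (N * (K + 1))) ^ 2 = (((1 / 2 : ℝ) ^ (K + 1)) ^ 2) ^ N := by
          rw [← pow_mul, ← pow_mul, ← pow_mul]; congr 1; ring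
      _ ≤ ((t ^ 4 / √s) ^ 2) ^ N := by gcongr
      _ = t ^ (8 * N) / s ^ N := by
          rw [div_pow, hsq, div_pow, ← pow_mul, ← pow_mul, ← mul_assoc]
          norm_num
  have htN : 1 ≤ t ^ (8 * N) := one_le_pow₀ (by linarith)
  rw [hexp]
  calc (((1 : ℝ) / 2) ^ (N * (K + 1))) ^ 2 + 2 * N * (1 / s ^ N)
      ≤ t ^ (8 * N) / s ^ N + 2 * N * (t ^ (8 * N) / s ^ N) := by gcongr
    _ = (1 + 2 * N) * t ^ (8 * N) / s ^ N := by ring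

/-- Decoding to `0` at all outputs is the fallback at small signal-to-noise ratios. -/
theorem exists_interleaveScheme_distortion_le_one (P σ : ℝ≥0) :
    ∃ (ψ : (Fin N → ℝ) → ℝ) (hψ : Measurable ψ),
      (interleaveScheme P ψ hψ).distortion unif σ ≤ 1 := by
  refine ⟨fun _ => 0, measurable_const, ?_⟩
  rw [Scheme.distortion_eq]
  have hsource : ∀ᵐ p ∂((sourceLaw unif 1).prod (noiseLaw σ N)),
      p.1 0 + 1 / 2 ∈ Set.Ico (0 : ℝ) 1 :=
    measurePreserving_fst.quasiMeasurePreserving.ae ae_sourceLaw_unif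
  calc ∫⁻ p, ENNReal.ofReal ((interleaveScheme P (fun _ => 0) measurable_const).err p ^ 2)
        ∂((sourceLaw unif 1).prod (noiseLaw σ N))
      ≤ ∫⁻ _, 1 ∂((sourceLaw unif 1).prod (noiseLaw σ N)) := by
        refine lintegral_mono_ae (hsource.mono fun p hp => ENNReal.ofReal_le_one.2 ?_)
        obtain ⟨h1, h2⟩ := hp
        rw [show (interleaveScheme (P : ℝ) (fun _ => 0) measurable_const).err p = p.1 0 - 0 from
          rfl, sq_le_one_iff_abs_le_one, abs_le]
        constructor <;> linarith
    _ = 1 := by simp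

/-- The distortion reached at signal-to-noise ratio `s`: the asymptotic bound from a threshold
`s₀` on, and the trivial bound below it. -/
noncomputable def distortionBound (N : ℕ) (s₀ s : ℝ) : ℝ :=
  if s₀ ≤ s then (1 + 2 * N) * lg s ^ (8 * N) / s ^ N else 1

/-- The error term in the lower bound for the signal-to-distortion ratio: a constant from the
threshold on, and below it the value that turns the bound into an equality. -/
noncomputable def sdrRemainder (N : ℕ) (s₀ s : ℝ) : ℝ :=
  if s₀ ≤ s then -lg (12 * (1 + 2 * N))
  else lg (1 / 12) - N * lg s + 10 * N * lg (lg s)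

theorem sdrRemainder_isLittleO (N : ℕ) (s₀ : ℝ) :
    sdrRemainder N s₀ =o[atTop] fun s => lg (lg s) := by
  have h : (fun _ : ℝ => -lg (12 * (1 + 2 * N))) =o[atTop] fun s => lg (lg s) :=
    isLittleO_const_left.2 (Or.inr
      (tendsto_norm_atTop_atTop.comp (tendsto_lg.comp tendsto_lg)))
  refine h.congr' ?_ EventuallyEq.rfl
  filter_upwards [eventually_ge_atTop s₀] with s hs
  rw [sdrRemainder, if_pos hs]

theorem lg_sdr_distortionBound {s₀ s : ℝ} {D : ℝ≥0} (hs : s₀ ≤ s) (hs0 : 0 < s)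
    (hlg : 0 < lg s) (hD : (D : ℝ) = distortionBound N s₀ s) :
    lg (sdr unif D) = N * lg s - 8 * N * lg (lg s) - lg (12 * (1 + 2 * N)) := by
  have h : sdr unif D = s ^ N / (lg s ^ (8 * N) * (12 * (1 + 2 * N))) := by
    rw [sdr, variance_unif, hD, distortionBound, if_pos hs]
    field_simp
  rw [h, lg_div (by positivity) (by positivity), lg_mul (by positivity) (by positivity), lg_pow,
    lg_pow]
  push_cast
  ring

theorem le_lg_sdr_distortionBound {s₀ s : ℝ} {D : ℝ≥0} (hs₀ : 2 ≤ lg s₀) (hs₀0 : 0 < s₀)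
    (hD : (D : ℝ) = distortionBound N s₀ s) :
    N * lg s - 10 * N * lg (lg s) + sdrRemainder N s₀ s ≤ lg (sdr unif D) := by
  by_cases hs : s₀ ≤ s
  · have hlg : 2 ≤ lg s := hs₀.trans (lg_le_lg hs₀0 hs)
    have hll : 0 ≤ lg (lg s) := Real.logb_nonneg one_lt_two (by linarith)
    rw [lg_sdr_distortionBound hs (hs₀0.trans_le hs) (by linarith) hD, sdrRemainder, if_pos hs]
    nlinarith [mul_nonneg (Nat.cast_nonneg N : (0 : ℝ) ≤ N) hll]
  · rw [sdrRemainder, if_neg hs, sdr, variance_unif, hD, distortionBound, if_neg hs, div_one]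
    linarith

theorem abs_sub_lg_sdr_distortionBound_le {s₀ s : ℝ} {D : ℝ≥0} (hs₀ : 2 ≤ lg s₀)
    (hs₀1 : 1 ≤ s₀) (hs : s₀ ≤ s) (hD : (D : ℝ) = distortionBound N s₀ s) :
    |N * lg (1 + s) - lg (sdr unif D)| ≤
      (9 * N + |lg (12 * (1 + 2 * N))|) * lg (lg s) := by
  have hs1 : 1 ≤ s := hs₀1.trans hs
  have hlg : 2 ≤ lg s := hs₀.trans (lg_le_lg (by linarith) hs)
  have hlg2 : lg 2 = 1 := Real.logb_self_eq_one one_lt_two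
  have hll : 1 ≤ lg (lg s) := hlg2 ▸ lg_le_lg two_pos hlg
  have h1 : lg s ≤ lg (1 + s) := lg_le_lg (by linarith) (by linarith)
  have h2 : lg (1 + s) ≤ 1 + lg s := by
    rw [← hlg2, ← lg_mul two_ne_zero (by linarith)]
    exact lg_le_lg (by linarith) (by linarith)
  have hN : (0 : ℝ) ≤ N := Nat.cast_nonneg N
  have h3 : (N : ℝ) * lg (1 + s) ≤ N * (1 + lg s) := by gcongr
  have h4 : (N : ℝ) * lg s ≤ N * lg (1 + s) := by gcongr
  have h5 : (N : ℝ) ≤ N * lg (lg s) := le_mul_of_one_le_right hN hll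
  have h6 := le_mul_of_one_le_right (abs_nonneg (lg (12 * (1 + 2 * (N : ℝ))))) hll
  have h7 := abs_le.1 (le_refl |lg (12 * (1 + 2 * (N : ℝ)))|)
  rw [lg_sdr_distortionBound hs (by linarith) (by linarith) hD, abs_le]
  constructor <;> linarith

/-- One channel-agnostic strategy that reaches `distortionBound` at all channels. -/
theorem exists_strategy (hN : 1 ≤ N) :
    ∃ s₀ : ℝ, 1 ≤ s₀ ∧ 2 ≤ lg s₀ ∧ ∃ A : Strategy 1 N, A.IsChannelAgnostic ∧
      (∀ P σ : ℝ≥0, (A P σ).power unif ≤ P) ∧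
      ∃ D : ℝ≥0 → ℝ≥0 → ℝ≥0, ∀ P σ : ℝ≥0, 0 < σ →
        0 < D P σ ∧ (D P σ : ℝ) = distortionBound N s₀ (snr P σ) ∧
          (A P σ).distortion unif σ ≤ D P σ := by
  obtain ⟨s₀, hs₀⟩ := eventually_atTop.1 ((eventually_gt_atTop (1 : ℝ)).and
    ((tendsto_lg.eventually_ge_atTop (2048 * N : ℝ)).and eventually_lg_pow_four_le_sqrt))
  have hN1 : (1 : ℝ) ≤ N := by exact_mod_cast hN
  have hpos : ∀ s, 0 < distortionBound N s₀ s := by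
    intro s
    unfold distortionBound
    split_ifs with hs
    · obtain ⟨h1, h2, -⟩ := hs₀ s hs
      have : 0 < lg s := by linarith
      have : 0 < s := by linarith
      positivity
    · exact one_pos
  have hdec : ∀ P σ : ℝ≥0, ∃ (ψ : (Fin N → ℝ) → ℝ) (hψ : Measurable ψ), 0 < σ →
      (interleaveScheme P ψ hψ).distortion unif σ ≤
        ENNReal.ofReal (distortionBound N s₀ (snr P σ)) := by
    intro P σ
    by_cases hs : 0 < σ ∧ s₀ ≤ snr P σ
    · obtain ⟨h1, h2, h3⟩ := hs₀ _ hs.2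
      obtain ⟨ψ, hψ, h⟩ := exists_interleaveScheme_distortion_le hN hs.1 rfl h1 h2 h3
      exact ⟨ψ, hψ, fun _ => by rwa [distortionBound, if_pos hs.2]⟩
    · obtain ⟨ψ, hψ, h⟩ := exists_interleaveScheme_distortion_le_one (N := N) P σ
      exact ⟨ψ, hψ, fun hσ => by
        rwa [distortionBound, if_neg fun h' => hs ⟨hσ, h'⟩, ENNReal.ofReal_one]⟩
  choose ψ hψ hdist using hdec
  refine ⟨s₀, (hs₀ s₀ le_rfl).1.le, by linarith [(hs₀ s₀ le_rfl).2.1],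
    fun P σ => interleaveScheme P (ψ P σ) (hψ P σ), ⟨interleave, fun _ _ _ _ _ _ => rfl⟩,
    fun P σ => interleaveScheme_power_le P _ _,
    fun P σ => (distortionBound N s₀ (snr P σ)).toNNReal, fun P σ hσ =>
      ⟨Real.toNNReal_pos.2 (hpos _), Real.coe_toNNReal _ (hpos _).le, hdist P σ hσ⟩⟩

/-- The optimum inherits both bounds: from below the one that holds for every scheme, from above
the distortion of any given strategy. -/
theorem optDistortion_pos_and_le (hN : 1 ≤ N) {P σ D : ℝ≥0} (hσ : 0 < σ)
    {A : Strategy 1 N} (hA : A.IsChannelAgnostic)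
    (hpow : ∀ P' σ' : ℝ≥0, 0 < P' → 0 < σ' → (A P' σ').power unif ≤ P')
    (hach : (A P σ).Achieves unif σ P D) :
    0 < optDistortion unif 1 N P σ ∧ optDistortion unif 1 N P σ ≤ D ∧
      sdr unif (optDistortion unif 1 N P σ) ≤
        (1 + snr P σ) ^ N * (Real.pi * Real.exp 1 / 6) := by
  have hsnr : 0 ≤ snr P σ := by unfold snr; positivity
  set b : ℝ := 1 / (2 * Real.pi * Real.exp 1 * (1 + snr P σ) ^ N) with hb_def
  have hb : 0 < b := by positivity
  have hlow : ∀ (S : Scheme 1 N) (d : ℝ≥0), S.Achieves unif σ P d → b ≤ d := by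
    intro S d hS
    -- `Scheme.Achieves.one_le` needs a positive distortion; the increase by `ε` covers `d = 0`.
    refine le_of_forall_pos_le_add fun ε hε => ?_
    have hS' : S.Achieves unif σ P (d + ε.toNNReal) :=
      ⟨hS.1, hS.2.trans (by gcongr; exact le_self_add)⟩
    have h := hS'.one_le hN hσ (add_pos_of_nonneg_of_pos zero_le (Real.toNNReal_pos.2 hε))
    rw [NNReal.coe_add, Real.coe_toNNReal _ hε.le] at h
    rw [hb_def, div_le_iff₀ (by positivity)]
    linarith
  have hle : b ≤ optDistortion unif 1 N P σ := by
    rw [← Real.coe_toNNReal b hb.le, NNReal.coe_le_coe]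
    refine le_csInf ⟨D, A, hA, hpow, hach⟩ ?_
    rintro d ⟨A', -, -, hach'⟩
    exact Real.toNNReal_le_iff_le_coe.2 (hlow _ _ hach')
  have hpos : (0 : ℝ) < optDistortion unif 1 N P σ := hb.trans_le hle
  refine ⟨hpos, csInf_le (OrderBot.bddBelow _) ⟨A, hA, hpow, hach⟩, ?_⟩
  rw [hb_def, div_le_iff₀ (by positivity)] at hle
  rw [sdr, variance_unif, div_le_iff₀ hpos]
  linarith

end FewShot

theorem corollary1 (N : ℕ) (hN : 1 ≤ N) :
    -- the optimum is a positive number, and satisfies the information-theoretic upper bound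
    (∀ P σ : ℝ≥0, 0 < P → 0 < σ →
      0 < FewShot.optDistortion FewShot.unif 1 N P σ ∧
      FewShot.lg (FewShot.sdr FewShot.unif (FewShot.optDistortion FewShot.unif 1 N P σ)) ≤
        N * FewShot.lg (1 + FewShot.snr P σ) + FewShot.lg (Real.pi * Real.exp 1 / 6)) ∧
    -- the lower bound for the optimum
    (∃ r : ℝ → ℝ, r =o[atTop] (fun s => FewShot.lg (FewShot.lg s)) ∧
      ∀ P σ : ℝ≥0, 0 < P → 0 < σ → 1 < FewShot.snr P σ →
        N * FewShot.lg (FewShot.snr P σ)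
            - 10 * N * FewShot.lg (FewShot.lg (FewShot.snr P σ)) + r (FewShot.snr P σ) ≤
          FewShot.lg
            (FewShot.sdr FewShot.unif (FewShot.optDistortion FewShot.unif 1 N P σ))) ∧
    -- one channel-agnostic strategy attains the lower bound at all channels simultaneously
    (∃ A : FewShot.Strategy 1 N, A.IsChannelAgnostic ∧
      ∃ D : ℝ≥0 → ℝ≥0 → ℝ≥0,
        (∀ P σ : ℝ≥0, 0 < P → 0 < σ →
          0 < D P σ ∧ (A P σ).Achieves FewShot.unif σ P (D P σ)) ∧
        (∃ r : ℝ → ℝ, r =o[atTop] (fun s => FewShot.lg (FewShot.lg s)) ∧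
          ∀ P σ : ℝ≥0, 0 < P → 0 < σ → 1 < FewShot.snr P σ →
            N * FewShot.lg (FewShot.snr P σ)
                - 10 * N * FewShot.lg (FewShot.lg (FewShot.snr P σ)) + r (FewShot.snr P σ) ≤
              FewShot.lg (FewShot.sdr FewShot.unif (D P σ))) ∧
        -- hence it is within `O(log log SNR)` of the information-theoretic bound
        (∃ C s₀ : ℝ, ∀ P σ : ℝ≥0, 0 < P → 0 < σ → s₀ ≤ FewShot.snr P σ →
          |N * FewShot.lg (1 + FewShot.snr P σ) - FewShot.lg (FewShot.sdr FewShot.unif (D P σ))|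
            ≤ C * FewShot.lg (FewShot.lg (FewShot.snr P σ)))) := by
  obtain ⟨s₀, hs₀1, hs₀, A, hA, hpow, D, hD⟩ := FewShot.exists_strategy hN
  have hach : ∀ P σ : ℝ≥0, 0 < P → 0 < σ →
      (A P σ).Achieves FewShot.unif σ P (D P σ) := fun P σ _ hσ =>
    ⟨hpow P σ, (hD P σ hσ).2.2⟩
  have hopt := fun (P σ : ℝ≥0) (hP : 0 < P) (hσ : 0 < σ) =>
    FewShot.optDistortion_pos_and_le hN hσ hA (fun P' σ' _ _ => hpow P' σ') (hach P σ hP hσ)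
  have hsdr : ∀ d : ℝ≥0, 0 < d → 0 < FewShot.sdr FewShot.unif d := fun d hd => by
    have : (0 : ℝ) < d := hd
    rw [FewShot.sdr, FewShot.variance_unif]; positivity
  have hlower := fun (P σ : ℝ≥0) (hσ : 0 < σ) =>
    FewShot.le_lg_sdr_distortionBound hs₀ (by linarith) (hD P σ hσ).2.1
  refine ⟨fun P σ hP hσ => ⟨(hopt P σ hP hσ).1, ?_⟩,
    ⟨_, FewShot.sdrRemainder_isLittleO N s₀, fun P σ hP hσ _ => (hlower P σ hσ).trans ?_⟩,
    A, hA, D, fun P σ hP hσ => ⟨(hD P σ hσ).1, hach P σ hP hσ⟩,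
    ⟨_, FewShot.sdrRemainder_isLittleO N s₀, fun P σ _ hσ _ => hlower P σ hσ⟩,
    _, s₀, fun P σ _ hσ hs =>
      FewShot.abs_sub_lg_sdr_distortionBound_le hs₀ hs₀1 hs (hD P σ hσ).2.1⟩
  · have hsnr : 0 ≤ FewShot.snr P σ := by unfold FewShot.snr; positivity
    rw [← FewShot.lg_pow, ← FewShot.lg_mul (by positivity) (by positivity)]
    exact FewShot.lg_le_lg (hsdr _ (hopt P σ hP hσ).1) (hopt P σ hP hσ).2.2
  · obtain ⟨h1, h2, -⟩ := hopt P σ hP hσ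
    refine FewShot.lg_le_lg (hsdr _ (hD P σ hσ).1) ?_
    unfold FewShot.sdr
    have h1' : (0 : ℝ) < FewShot.optDistortion FewShot.unif 1 N P σ := h1
    rw [FewShot.variance_unif]
    gcongr
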